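/- **Setting.** Let $\langle x,y\rangle_L=-x_0y_0+x_1y_1+x_2y_2+x_3y_3$ on $\mathbb R^4$, let $\mathbb H^3=\{\langle x,x\rangle_L=-1,\ x_0>0\}$ with geodesic distance determined by $\cosh\operatorname{dist}(p,q)=-\langle p,q\rangle_L$, and let $p_0=(1,0,0,0)$. For $a>1/2$ put $$A(s)=\sqrt{a\cosh 2s+\tfrac12},\quad B(s)=\sqrt{a\cosh 2s-\tfrac12},\quad K=K(a)=\sqrt{a^2-\tfrac14},\quad \varphi(s)=\int_0^s\frac{K\,dt}{A(t)^2B(t)},$$ and let $$X_a(s,\theta)=\bigl(A\cosh\varphi,\ A\sinh\varphi,\ B\cos\theta,\ B\sin\theta\bigr)$$ be the Mori family of rotationally symmetric minimal surfaces in $\mathbb H^3$. Its unit normal $\nu_a$ in $\mathbb H^3$ is oriented so that its third coordinate (the one of index $2$) equals $K/B(s)>0$ at $\theta=0$. Let $s_0(a)$ be the unique $s>0$ satisfying the free boundary condition $$\tanh\varphi(s)=\frac{B(s)\,K}{a\sinh 2s},$$ let $r(a)=\operatorname{dist}(p_0,X_a(s_0(a),0))$, let $y(a)=B(s_0(a))^2/K(a)^2$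 (with $B$ taken at the parameter $a$), and let $$\phi_a(s)=\langle\partial_aX_a(s,\theta),\nu_a(s,\theta)\rangle_L ,$$ where $\partial_a$ is taken at fixed $(s,\theta)$; the right-hand side does not depend on $\theta$. **Theorem.** Let $a>1/2$. The map $b\mapsto X_b(s,\theta)$ (for all $s,\theta$) and the functions $r$ and $y$ are differentiable at $a$, and the two forms $$B(s_0(a))^2>2K(a)^2\qquad\text{and}\qquad \sinh r(a)>2K(a)$$ of the strict pinching condition are equivalent. If this condition holds, then the following are equivalent: 1. $\phi_a(s)>0$ for every $s\in[0,s_0(a)]$; 2. $\phi_a(s_0(a))>0$; 3. $K(a)^2\,r'(a)\coth r(a)>a$, which is the same as $(a^2-\tfrac14)\,r'(a)>a\tanh r(a)$; 4. $\dfrac{d}{da}\left[\dfrac{\sinh r(a)}{K(a)}\right]>0$; 5. $y'(a)>0$. -/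

import Mathlib

open Real

noncomputable section

namespace HypCatenoid

/-- The Lorentz inner product `-x₀y₀ + x₁y₁ + x₂y₂ + x₃y₃` on `ℝ⁴`. -/
def lorentz (x y : Fin 4 → ℝ) : ℝ :=
  -(x 0 * y 0) + x 1 * y 1 + x 2 * y 2 + x 3 * y 3

/-- The pole `p₀ = (1, 0, 0, 0)` of the hyperboloid model of `ℍ³`. -/
def pole : Fin 4 → ℝ := ![1, 0, 0, 0]

/-- Geodesic distance in the hyperboloid model: `cosh (dist p q) = -⟨p, q⟩`. -/
def hypDist (p q : Fin 4 → ℝ) : ℝ := arcosh (-lorentz p q)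

/-- `A(s)`, with `A(s)² = a cosh (2s) + 1/2`. -/
def profileA (a s : ℝ) : ℝ := √(a * cosh (2 * s) + 1 / 2)

/-- `B(s)`, with `B(s)² = a cosh (2s) - 1/2`. -/
def profileB (a s : ℝ) : ℝ := √(a * cosh (2 * s) - 1 / 2)

/-- `K(a) = √(a² - 1/4)`. -/
def neckK (a : ℝ) : ℝ := √(a ^ 2 - 1 / 4)

/-- The angle `φ(s)`: `φ(0) = 0`, `φ'(s) = K / (A(s)² B(s))`. -/
def angle (a s : ℝ) : ℝ :=
  ∫ t in (0 : ℝ)..s, neckK a / (profileA a t ^ 2 * profileB a t)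

/-- The Mori immersion `X_a(s, θ)`, a rotationally symmetric minimal surface in `ℍ³`. -/
def moriX (a s θ : ℝ) : Fin 4 → ℝ :=
  ![profileA a s * cosh (angle a s), profileA a s * sinh (angle a s),
    profileB a s * cos θ, profileB a s * sin θ]

/-- The unit normal `ν_a(s, θ)` of the Mori immersion in `ℍ³`, oriented by `ν² = K / B > 0` along
`θ = 0`. See `lorentz_normal_self` and the three orthogonality lemmas below. -/
def unitNormal (a s θ : ℝ) : Fin 4 → ℝ :=
  ![neckK a * cosh (angle a s) / profileA a s
      - a * sinh (2 * s) * sinh (angle a s) / (profileA a s * profileB a s),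
    neckK a * sinh (angle a s) / profileA a s
      - a * sinh (2 * s) * cosh (angle a s) / (profileA a s * profileB a s),
    neckK a / profileB a s * cos θ, neckK a / profileB a s * sin θ]

/-- The free boundary condition at the parameter `s > 0`:
`tanh φ(s) = B(s) K / (a sinh (2s))`. -/
def IsFreeBoundary (a s : ℝ) : Prop :=
  0 < s ∧ tanh (angle a s) = profileB a s * neckK a / (a * sinh (2 * s))

/-- The free boundary parameter `s₀(a)`. For `a > 1/2` it is the unique solution of the free
boundary condition, see `existsUnique_isFreeBoundary` and `isFreeBoundary_s0`. -/
def s0 (a : ℝ) : ℝ := sInf {s | IsFreeBoundary a s}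

/-- `r(a)`, the distance from the pole to the boundary of the critical catenoid. -/
def radius (a : ℝ) : ℝ := hypDist pole (moriX a (s0 a) 0)

/-- The parametric Jacobi field `⟨∂ₐ X_a(s, θ), ν_a(s, θ)⟩` (`∂ₐ` at fixed `(s, θ)`). -/
def paramJacobi (a s θ : ℝ) : ℝ :=
  lorentz (fun i => deriv (fun b => moriX b s θ i) a) (unitNormal a s θ)

/-- `φ_a(s)`: the parametric Jacobi field does not depend on `θ`, see `paramJacobi_eq_phi`. -/
def phi (a s : ℝ) : ℝ := paramJacobi a s 0

/-- `y(a) = B(s₀(a))² / K(a)²`. -/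
def ratioY (a : ℝ) : ℝ := profileB a (s0 a) ^ 2 / neckK a ^ 2

/-! Facts showing that the definitions above describe the intended objects. -/

section facts

variable {a : ℝ}

theorem half_lt_mul_cosh (ha : 1 / 2 < a) (s : ℝ) : 1 / 2 < a * cosh (2 * s) := by
  nlinarith [one_le_cosh (2 * s)]

theorem profileA_pos (ha : 1 / 2 < a) (s : ℝ) : 0 < profileA a s :=
  sqrt_pos.2 (by linarith [half_lt_mul_cosh ha s])

theorem profileB_pos (ha : 1 / 2 < a) (s : ℝ) : 0 < profileB a s :=
  sqrt_pos.2 (by linarith [half_lt_mul_cosh ha s])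

theorem neckK_pos (ha : 1 / 2 < a) : 0 < neckK a := sqrt_pos.2 (by nlinarith)

theorem profileA_sq (ha : 1 / 2 < a) (s : ℝ) :
    profileA a s ^ 2 = a * cosh (2 * s) + 1 / 2 :=
  sq_sqrt (by linarith [half_lt_mul_cosh ha s])

theorem profileB_sq (ha : 1 / 2 < a) (s : ℝ) :
    profileB a s ^ 2 = a * cosh (2 * s) - 1 / 2 :=
  sq_sqrt (by linarith [half_lt_mul_cosh ha s])

theorem neckK_sq (ha : 1 / 2 < a) : neckK a ^ 2 = a ^ 2 - 1 / 4 := sq_sqrt (by nlinarith)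

theorem hasDerivAt_profileA (ha : 1 / 2 < a) (s : ℝ) :
    HasDerivAt (profileA a) (a * sinh (2 * s) / profileA a s) s := by
  have h2 : HasDerivAt (fun s : ℝ => 2 * s) 2 s := by simpa using (hasDerivAt_id s).const_mul 2
  have h := ((h2.cosh.const_mul a).add_const (1 / 2)).sqrt
    (by linarith [half_lt_mul_cosh ha s])
  refine h.congr_deriv ?_
  have := profileA_pos ha s
  change _ / (2 * profileA a s) = _
  field_simp

theorem hasDerivAt_profileB (ha : 1 / 2 < a) (s : ℝ) :
    HasDerivAt (profileB a) (a * sinh (2 * s) / profileB a s) s := by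
  have h2 : HasDerivAt (fun s : ℝ => 2 * s) 2 s := by simpa using (hasDerivAt_id s).const_mul 2
  have h := ((h2.cosh.const_mul a).sub_const (1 / 2)).sqrt
    (by linarith [half_lt_mul_cosh ha s])
  refine h.congr_deriv ?_
  have := profileB_pos ha s
  change _ / (2 * profileB a s) = _
  field_simp

theorem hasDerivAt_angle (ha : 1 / 2 < a) (s : ℝ) :
    HasDerivAt (angle a) (neckK a / (profileA a s ^ 2 * profileB a s)) s := by
  have hA : Continuous (profileA a) :=
    continuous_iff_continuousAt.2 fun s => (hasDerivAt_profileA ha s).continuousAt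
  have hB : Continuous (profileB a) :=
    continuous_iff_continuousAt.2 fun s => (hasDerivAt_profileB ha s).continuousAt
  have hc : Continuous fun t => neckK a / (profileA a t ^ 2 * profileB a t) :=
    continuous_const.div ((hA.pow 2).mul hB) fun t =>
      (mul_pos (pow_pos (profileA_pos ha t) 2) (profileB_pos ha t)).ne'
  exact intervalIntegral.integral_hasDerivAt_right (hc.intervalIntegrable _ _)
    (hc.stronglyMeasurableAtFilter _ _) hc.continuousAt

/-- The relation `a² sinh² (2s) + K² = A² B²`. -/
theorem mori_relation (ha : 1 / 2 < a) (s : ℝ) :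
    (a * sinh (2 * s)) ^ 2 + neckK a ^ 2 = profileA a s ^ 2 * profileB a s ^ 2 := by
  rw [profileA_sq ha, profileB_sq ha, neckK_sq ha]
  nlinarith [cosh_sq (2 * s)]

theorem lorentz_moriX_self (ha : 1 / 2 < a) (s θ : ℝ) :
    lorentz (moriX a s θ) (moriX a s θ) = -1 := by
  simp only [lorentz, moriX, Matrix.cons_val]
  have h1 := cosh_sq (angle a s)
  have h2 := sin_sq_add_cos_sq θ
  linear_combination (-profileA a s ^ 2) * h1 + (profileB a s ^ 2) * h2
    - profileA_sq ha s + profileB_sq ha s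

theorem lorentz_normal_self (ha : 1 / 2 < a) (s θ : ℝ) :
    lorentz (unitNormal a s θ) (unitNormal a s θ) = 1 := by
  simp only [lorentz, unitNormal, Matrix.cons_val]
  have hA := profileA_pos ha s
  have hB := profileB_pos ha s
  have h1 := cosh_sq (angle a s)
  have h2 := sin_sq_add_cos_sq θ
  have h3 := mori_relation ha s
  have h4 : profileA a s ^ 2 = profileB a s ^ 2 + 1 := by
    rw [profileA_sq ha, profileB_sq ha]; ring
  have h5 : (neckK a ^ 2 + (a * sinh (2 * s)) ^ 2) / (profileA a s ^ 2 * profileB a s ^ 2) = 1 := by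
    rw [add_comm, h3]; exact div_self (by positivity)
  have h6 : neckK a ^ 2 / profileB a s ^ 2 - neckK a ^ 2 / profileA a s ^ 2
      = neckK a ^ 2 / (profileA a s ^ 2 * profileB a s ^ 2) := by
    field_simp
    linear_combination neckK a ^ 2 * h4
  linear_combination (-neckK a ^ 2 / profileA a s ^ 2
    + (a * sinh (2 * s)) ^ 2 / (profileA a s * profileB a s) ^ 2) * h1
    + (neckK a / profileB a s) ^ 2 * h2 + h5 + h6

theorem lorentz_normal_moriX (ha : 1 / 2 < a) (s θ : ℝ) :
    lorentz (unitNormal a s θ) (moriX a s θ) = 0 := by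
  simp only [lorentz, unitNormal, moriX, Matrix.cons_val]
  have hA := profileA_pos ha s
  have hB := profileB_pos ha s
  have h1 := cosh_sq (angle a s)
  have h2 := sin_sq_add_cos_sq θ
  field_simp
  linear_combination (-neckK a * profileB a s) * h1 + neckK a * profileB a s * h2

theorem hasDerivAt_moriX_s (ha : 1 / 2 < a) (s θ : ℝ) :
    HasDerivAt (fun t => moriX a t θ)
      ![a * sinh (2 * s) / profileA a s * cosh (angle a s)
          + profileA a s * (sinh (angle a s) * (neckK a / (profileA a s ^ 2 * profileB a s))),
        a * sinh (2 * s) / profileA a s * sinh (angle a s)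
          + profileA a s * (cosh (angle a s) * (neckK a / (profileA a s ^ 2 * profileB a s))),
        a * sinh (2 * s) / profileB a s * cos θ, a * sinh (2 * s) / profileB a s * sin θ] s := by
  rw [hasDerivAt_pi]
  have hA := hasDerivAt_profileA ha s
  have hB := hasDerivAt_profileB ha s
  have hp := hasDerivAt_angle ha s
  intro i
  fin_cases i
  · exact hA.mul hp.cosh
  · exact hA.mul hp.sinh
  · exact hB.mul_const _
  · exact hB.mul_const _

theorem lorentz_normal_deriv_s (ha : 1 / 2 < a) (s θ : ℝ) :
    lorentz (unitNormal a s θ) (deriv (fun t => moriX a t θ) s) = 0 := by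
  rw [(hasDerivAt_moriX_s ha s θ).deriv]
  simp only [lorentz, unitNormal, Matrix.cons_val]
  have hA := profileA_pos ha s
  have hB := profileB_pos ha s
  have h1 := cosh_sq (angle a s)
  have h2 := sin_sq_add_cos_sq θ
  have h4 : profileA a s ^ 2 = profileB a s ^ 2 + 1 := by
    rw [profileA_sq ha, profileB_sq ha]; ring
  have h5 : neckK a * (a * sinh (2 * s)) * (1 / profileB a s ^ 2 - 1 / profileA a s ^ 2
      - 1 / (profileA a s ^ 2 * profileB a s ^ 2)) = 0 := by
    field_simp; rw [h4]; ring
  have h6 : profileA a s * (1 / profileA a s) = 1 := by field_simp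
  linear_combination (-neckK a * (a * sinh (2 * s)) / profileA a s ^ 2
    - a * sinh (2 * s) * neckK a / (profileA a s ^ 2 * profileB a s ^ 2)) * h1
    + neckK a * (a * sinh (2 * s)) / profileB a s ^ 2 * h2 + h5
    - neckK a * (a * sinh (2 * s)) / (profileA a s ^ 2 * profileB a s ^ 2)
      * (cosh (angle a s) ^ 2 - sinh (angle a s) ^ 2) * h6

theorem hasDerivAt_moriX_θ (a s θ : ℝ) :
    HasDerivAt (fun t => moriX a s t)
      ![0, 0, profileB a s * -sin θ, profileB a s * cos θ] θ := by
  rw [hasDerivAt_pi]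
  intro i
  fin_cases i
  · exact hasDerivAt_const _ _
  · exact hasDerivAt_const _ _
  · exact (hasDerivAt_cos θ).const_mul _
  · exact (hasDerivAt_sin θ).const_mul _

theorem lorentz_normal_deriv_θ (a s θ : ℝ) :
    lorentz (unitNormal a s θ) (deriv (fun t => moriX a s t) θ) = 0 := by
  rw [(hasDerivAt_moriX_θ a s θ).deriv]
  simp only [lorentz, unitNormal, Matrix.cons_val]
  ring

/-- The free boundary condition says that `ν` is orthogonal to the radial direction, that is, to
the component of `p₀` tangent to `ℍ³`. -/
theorem isFreeBoundary_iff (ha : 1 / 2 < a) {s : ℝ} (hs : 0 < s) :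
    IsFreeBoundary a s ↔ lorentz (unitNormal a s 0) pole = 0 := by
  have hA := profileA_pos ha s
  have hB := profileB_pos ha s
  have h0 : 0 < a * sinh (2 * s) := mul_pos (by linarith) (sinh_pos_iff.2 (by linarith))
  have hc := cosh_pos (angle a s)
  simp only [IsFreeBoundary, hs, true_and, lorentz, unitNormal, pole, Matrix.cons_val,
    tanh_eq_sinh_div_cosh]
  rw [div_eq_div_iff hc.ne' h0.ne']
  constructor
  · intro h
    field_simp
    linear_combination h
  · intro h
    field_simp at h
    linear_combination h

/-- The parametric Jacobi field is independent of `θ`. -/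
theorem paramJacobi_eq_phi (a s θ : ℝ) : paramJacobi a s θ = phi a s := by
  simp only [phi, paramJacobi, lorentz, unitNormal, moriX, Matrix.cons_val, deriv_mul_const_field]
  have h2 := sin_sq_add_cos_sq θ
  simp only [cos_zero, sin_zero]
  linear_combination (deriv (fun b => profileB b s) a * (neckK a / profileB a s)) * h2

theorem tanh_lt_of_lt {x y : ℝ} (h : x < y) : tanh x < tanh y := by
  rw [tanh_eq_sinh_div_cosh, tanh_eq_sinh_div_cosh, div_lt_div_iff₀ (cosh_pos _) (cosh_pos _)]
  have := sinh_pos_iff.2 (sub_pos.2 h)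
  rw [sinh_sub] at this
  linarith

theorem angle_strictMono (ha : 1 / 2 < a) : StrictMono (angle a) :=
  strictMono_of_hasDerivAt_pos (hasDerivAt_angle ha) fun s =>
    div_pos (neckK_pos ha) (mul_pos (pow_pos (profileA_pos ha s) 2) (profileB_pos ha s))

/-- The quotient `B(s) / (a sinh (2s))` is strictly decreasing for `s > 0`. -/
theorem profileB_quotient_lt (ha : 1 / 2 < a) {s t : ℝ} (hs : 0 < s) (hst : s < t) :
    profileB a t / (a * sinh (2 * t)) < profileB a s / (a * sinh (2 * s)) := by
  have hS : 0 < sinh (2 * s) := sinh_pos_iff.2 (by linarith)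
  have hT : 0 < sinh (2 * t) := sinh_pos_iff.2 (by linarith)
  have hc1 : 1 < cosh (2 * s) := one_lt_cosh.2 (by linarith)
  have hc2 : cosh (2 * s) < cosh (2 * t) := by
    rw [cosh_lt_cosh, abs_of_pos (by linarith), abs_of_pos (by linarith)]; linarith
  rw [div_lt_div_iff₀ (by positivity) (by positivity)]
  refine lt_of_pow_lt_pow_left₀ 2
    (mul_pos (profileB_pos ha s) (by positivity)).le ?_
  simp only [mul_pow]
  rw [profileB_sq ha, profileB_sq ha, sinh_sq, sinh_sq]
  have ha2 : 0 < a ^ 2 := by positivity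
  set x := cosh (2 * s)
  set z := cosh (2 * t)
  have : (a * z - 1 / 2) * (x ^ 2 - 1) < (a * x - 1 / 2) * (z ^ 2 - 1) := by
    nlinarith [mul_pos (sub_pos.2 hc2) (sub_pos.2 hc1),
      mul_pos (sub_pos.2 hc2) (mul_pos (sub_pos.2 ha) (by nlinarith : 0 < x * z + 1)),
      mul_pos (sub_pos.2 hc2) (mul_pos (sub_pos.2 hc1) (sub_pos.2 (hc1.trans hc2)))]
  nlinarith

theorem existsUnique_isFreeBoundary (ha : 1 / 2 < a) : ∃! s, IsFreeBoundary a s := by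
  have ha0 : 0 < a := by linarith
  have hK := neckK_pos ha
  have h0 : angle a 0 = 0 := by simp [angle]
  have huniq : ∀ s t, IsFreeBoundary a s → IsFreeBoundary a t → ¬ s < t := by
    intro s t hs ht hst
    have h1 := mul_lt_mul_of_pos_right (profileB_quotient_lt ha hs.1 hst) hK
    have h2 : tanh (angle a s) < tanh (angle a t) := tanh_lt_of_lt (angle_strictMono ha hst)
    rw [hs.2, ht.2] at h2
    rw [div_mul_eq_mul_div, div_mul_eq_mul_div] at h1
    exact lt_asymm h1 h2
  have hB : Continuous (profileB a) :=
    continuous_iff_continuousAt.2 fun s => (hasDerivAt_profileB ha s).continuousAt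
  have hang : Continuous (angle a) :=
    continuous_iff_continuousAt.2 fun s => (hasDerivAt_angle ha s).continuousAt
  have hG : Continuous fun s => sinh (angle a s) * (a * sinh (2 * s))
      - profileB a s * neckK a * cosh (angle a s) := by fun_prop
  have hc : 0 < tanh (angle a 1) := by
    have h := angle_strictMono ha one_pos
    rw [h0] at h
    rw [tanh_eq_sinh_div_cosh]
    exact div_pos (sinh_pos_iff.2 h) (cosh_pos _)
  set c := tanh (angle a 1) with hcdef
  obtain ⟨w, hw0, hw⟩ := cosh_surjOn
    (show cosh 2 + neckK a ^ 2 / (c ^ 2 * a) ∈ Set.Ici (1 : ℝ) from by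
      have := one_le_cosh (2 : ℝ)
      have : 0 < neckK a ^ 2 / (c ^ 2 * a) := by positivity
      simp only [Set.mem_Ici]; linarith)
  have hw2 : 2 < w := by
    have : cosh 2 < cosh w := by
      have : 0 < neckK a ^ 2 / (c ^ 2 * a) := by positivity
      linarith
    rw [cosh_lt_cosh, abs_of_pos two_pos, abs_of_nonneg hw0] at this
    exact this
  have hpos : 0 < sinh (angle a (w / 2)) * (a * sinh (2 * (w / 2)))
      - profileB a (w / 2) * neckK a * cosh (angle a (w / 2)) := by
    have e : 2 * (w / 2) = w := by ring
    have hcw : c < tanh (angle a (w / 2)) := tanh_lt_of_lt (angle_strictMono ha (by linarith))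
    have hch := cosh_pos (angle a (w / 2))
    rw [tanh_eq_sinh_div_cosh, lt_div_iff₀ hch] at hcw
    have hsw : 0 < sinh w := sinh_pos_iff.2 (by linarith)
    have key : profileB a (w / 2) * neckK a < c * (a * sinh w) := by
      refine lt_of_pow_lt_pow_left₀ 2 (by positivity) ?_
      simp only [mul_pow]
      rw [profileB_sq ha, sinh_sq, e]
      have h1 : c ^ 2 * a * (cosh w - 1) ≥ neckK a ^ 2 := by
        have h2 : neckK a ^ 2 / (c ^ 2 * a) ≤ cosh w - 1 := by
          linarith [one_le_cosh (2 : ℝ)]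
        rw [div_le_iff₀ (by positivity)] at h2
        linarith
      have h3 : 0 < cosh w := cosh_pos w
      have h4 : 0 < a * (cosh w + 1) := by positivity
      have h5 := mul_le_mul_of_nonneg_right h1 h4.le
      have h6 : 0 < neckK a ^ 2 := by positivity
      nlinarith
    have h7 := mul_lt_mul_of_pos_right key hch
    have h8 := mul_lt_mul_of_pos_right hcw (mul_pos ha0 hsw)
    rw [e]
    nlinarith
  have hneg : sinh (angle a 0) * (a * sinh (2 * 0))
      - profileB a 0 * neckK a * cosh (angle a 0) < 0 := by
    have := profileB_pos ha 0
    rw [h0, mul_zero, sinh_zero, cosh_zero]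
    nlinarith [mul_pos this hK]
  obtain ⟨s, hs, hs0⟩ := intermediate_value_Ioo (by linarith : (0 : ℝ) ≤ w / 2)
    hG.continuousOn ⟨hneg, hpos⟩
  have hfb : IsFreeBoundary a s := by
    refine ⟨hs.1, ?_⟩
    have hS : 0 < a * sinh (2 * s) := mul_pos ha0 (sinh_pos_iff.2 (by linarith [hs.1]))
    rw [tanh_eq_sinh_div_cosh, div_eq_div_iff (cosh_pos _).ne' hS.ne']
    simp only at hs0
    linarith
  refine ⟨s, hfb, fun t ht => ?_⟩
  rcases lt_trichotomy s t with h | h | h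
  · exact (huniq _ _ hfb ht h).elim
  · exact h.symm
  · exact (huniq _ _ ht hfb h).elim

theorem isFreeBoundary_s0 (ha : 1 / 2 < a) : IsFreeBoundary a (s0 a) := by
  obtain ⟨s, hs, hu⟩ := existsUnique_isFreeBoundary ha
  have : {s | IsFreeBoundary a s} = {s} := Set.ext fun t => ⟨fun h => hu t h, fun h => h ▸ hs⟩
  rw [s0, this, csInf_singleton]
  exact hs

end facts

end HypCatenoid

end

open HypCatenoid

/-!
Let `P(a) = X_a(s₀(a), 0)` be the boundary point of the critical catenoid, in the totally geodesic
plane `θ = 0`, and `y = B² / K²` there.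

*The boundary data.* The free boundary condition says that the normal `ν` at `P` is orthogonal to
the pole `p₀`. Algebraically it becomes `P₁² (y - 1) = P₂²` (`boundaryPoint_one_sq_mul`), and since
`sinh² r = P₁² + P₂²` this gives `(sinh r / K)² = y² / (y - 1)` (`sinh_radius_div_sq_mul`). All
these quantities are differentiable in `a` because `s₀` is (`differentiableAt_s0`), by the implicit
function theorem; its hypothesis is the strict differentiability of the angle `φ` in both variables.

*The two forms of pinching.* Because `y² - 4 (y - 1) = (y - 2)²`, the condition `sinh r > 2 K`
amounts to `y ≠ 2`, whereas `B² > 2 K²` is `y > 2`. They agree because `y > 2` for every `a > 1/2`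
(`two_lt_ratioY`): were `y ≤ 2`, the free boundary condition would force `tanh φ ≥ K / (√2 a)`,
while `φ` is bounded above by an explicit multiple of `arsinh` (`angle_le_arsinh`) that is too
small.

*The signs at the boundary.* The derivative of `P` differs from `∂ₐ X` by a vector tangent to the
surface, so `φ_a(s₀) = ⟨P', ν⟩`. As `ν` is orthogonal to both `p₀` and `P`, this measures the
rotation of `P` around `p₀`, that is, the change of its elevation, seen from `p₀`, over the plane of
the rotations in `θ`, an angle whose sine is `1 / √y`; explicitly `2 P₂² φ_a(s₀) = K P₁² y'`
(`two_mul_phi_s0`). On the other hand `y² / (y - 1)` is strictly increasing for `y > 2`, so `y'` and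
`(sinh r / K)'` have the same sign, and the quotient rule expresses the latter through `r'`.

*From the boundary to the interior.* Both `φ_a` and `a sinh (2s) / B`, up to sign the normal
component of the translations along the axis, are Jacobi fields. Their weighted Wronskian is
constant, so their quotient has derivative `-a B / (K (a sinh (2s))²)`
(`hasDerivAt_jacobiQuotient`). It decreases, and positivity of `φ_a` at `s₀` propagates to
`(0, s₀]`; at `s = 0` it is evident.
-/

namespace HypCatenoid

open Filter Topology Set MeasureTheory

/-! ### Primitives depending on a parameter -/

section Primitive

variable {U : Set ℝ} {f f' : ℝ → ℝ → ℝ}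

theorem hasDerivAt_parametric_primitive (hU : IsOpen U)
    (hf : ContinuousOn (Function.uncurry f) (U ×ˢ univ))
    (hf' : ContinuousOn (Function.uncurry f') (U ×ˢ univ))
    (hd : ∀ b ∈ U, ∀ t, HasDerivAt (fun x => f x t) (f' b t) b) {b : ℝ} (hb : b ∈ U) (s : ℝ) :
    HasDerivAt (fun x => ∫ t in (0 : ℝ)..s, f x t) (∫ t in (0 : ℝ)..s, f' b t) b := by
  have hslice : ∀ {g : ℝ → ℝ → ℝ}, ContinuousOn (Function.uncurry g) (U ×ˢ univ) →
      ∀ x ∈ U, Continuous (g x) := fun {g} hg x hx =>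
    continuousOn_univ.1 <| hg.comp (f := fun t => (x, t)) (by fun_prop)
      fun t _ => ⟨hx, mem_univ t⟩
  obtain ⟨ε, hε, hball⟩ := Metric.nhds_basis_closedBall.mem_iff.1 (hU.mem_nhds hb)
  obtain ⟨M, hM⟩ := ((isCompact_closedBall b ε).prod
    (isCompact_uIcc (a := (0 : ℝ)) (b := s))).exists_bound_of_continuousOn
      (hf'.mono (prod_mono hball (subset_univ _)))
  refine (intervalIntegral.hasDerivAt_integral_of_dominated_loc_of_deriv_le
    (Metric.closedBall_mem_nhds b hε) (bound := fun _ => M) ?_ ?_ ?_ ?_ ?_ ?_).2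
  · filter_upwards [hU.mem_nhds hb] with x hx using (hslice hf x hx).aestronglyMeasurable
  · exact (hslice hf b hb).intervalIntegrable _ _
  · exact (hslice hf' b hb).aestronglyMeasurable
  · exact Eventually.of_forall fun t ht x hx => hM (x, t) ⟨hx, uIoc_subset_uIcc ht⟩
  · exact intervalIntegrable_const
  · exact Eventually.of_forall fun t _ x hx => hd x (hball hx) t

/-- The primitive `∫₀ˢ f(b, t) dt` of a function with continuous `b`-derivative is strictly
differentiable in the pair `(b, s)`, since both of its partial derivatives are continuous. -/
theorem hasStrictFDerivAt_parametric_primitive (hU : IsOpen U)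
    (hf : ContinuousOn (Function.uncurry f) (U ×ˢ univ))
    (hf' : ContinuousOn (Function.uncurry f') (U ×ˢ univ))
    (hd : ∀ b ∈ U, ∀ t, HasDerivAt (fun x => f x t) (f' b t) b) {b : ℝ} (hb : b ∈ U) (s : ℝ) :
    ∃ L : ℝ × ℝ →L[ℝ] ℝ,
      HasStrictFDerivAt (fun p : ℝ × ℝ => ∫ t in (0 : ℝ)..p.2, f p.1 t) L (b, s) := by
  have hslice : ∀ x ∈ U, Continuous (f x) := fun x hx =>
    continuousOn_univ.1 <| hf.comp (f := fun t => (x, t)) (by fun_prop)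
      fun t _ => ⟨hx, mem_univ t⟩
  have hUev : ∀ᶠ v : ℝ × ℝ in 𝓝 (b, s), v.1 ∈ U :=
    continuousAt_fst.eventually (hU.mem_nhds hb)
  have hcont : ContinuousAt (fun p : ℝ × ℝ => ∫ t in (0 : ℝ)..p.2, f' p.1 t) (b, s) := by
    have he := hU.isOpenEmbedding_subtypeVal.prodMap (Topology.IsOpenEmbedding.id (X := ℝ))
    refine (he.continuousAt_iff (x := ((⟨b, hb⟩ : U), s))).1 (Continuous.continuousAt ?_)
    have hg : Continuous (Function.uncurry fun (p : U × ℝ) (t : ℝ) => f' p.1 t) :=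
      hf'.comp_continuous (f := fun q : (U × ℝ) × ℝ => ((q.1.1 : ℝ), q.2)) (by fun_prop)
        fun q => ⟨q.1.1.2, mem_univ _⟩
    exact intervalIntegral.continuous_parametric_intervalIntegral_of_continuous hg continuous_snd
  refine ⟨_, hasStrictFDerivAt_uncurry_coprod (u := (b, s))
    (f := fun x y => ∫ t in (0 : ℝ)..y, f x t)
    (f₁ := fun x y => ContinuousLinearMap.toSpanSingleton ℝ (∫ t in (0 : ℝ)..y, f' x t))
    (f₂ := fun x y => ContinuousLinearMap.toSpanSingleton ℝ (f x y)) ?_ ?_ ?_ ?_⟩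
  · filter_upwards [hUev] with v hv
    exact (hasDerivAt_parametric_primitive hU hf hf' hd hv v.2).hasFDerivAt
  · filter_upwards [hUev] with v hv
    exact (intervalIntegral.integral_hasDerivAt_right ((hslice _ hv).intervalIntegrable _ _)
      ((hslice _ hv).stronglyMeasurableAtFilter _ _) (hslice _ hv).continuousAt).hasFDerivAt
  · exact (ContinuousLinearMap.toSpanSingletonCLE (𝕜 := ℝ) (E := ℝ)).continuous.continuousAt.comp
      hcont
  · refine (ContinuousLinearMap.toSpanSingletonCLE (𝕜 := ℝ) (E := ℝ)).continuous.continuousAt.comp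
      (f := Function.uncurry f) ?_
    exact hf.continuousAt ((hU.prod isOpen_univ).mem_nhds ⟨hb, mem_univ _⟩)

end Primitive

/-! ### Dependence of the immersion on the parameter -/

/-- `∂ₐ (K / (A² B))`, the parameter derivative of the density of the angle. -/
noncomputable def angleDensityDeriv (a t : ℝ) : ℝ :=
  a / neckK a / (profileA a t ^ 2 * profileB a t)
    - neckK a * cosh (2 * t) / (profileA a t ^ 4 * profileB a t)
    - neckK a * cosh (2 * t) / (2 * profileA a t ^ 2 * profileB a t ^ 3)

/-- `∂ₐ φ(s)` at fixed `s`, see `hasDerivAt_angle_param`. -/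
noncomputable def angleParamDeriv (a s : ℝ) : ℝ := ∫ t in (0 : ℝ)..s, angleDensityDeriv a t

section Param

variable {a : ℝ}

theorem hasDerivAt_neckK (ha : 1 / 2 < a) : HasDerivAt neckK (a / neckK a) a := by
  have h := ((hasDerivAt_pow 2 a).sub_const (1 / 4)).sqrt (by nlinarith)
  refine h.congr_deriv ?_
  have := neckK_pos ha
  change _ / (2 * neckK a) = _
  field_simp
  norm_num

theorem hasDerivAt_profileA_param (ha : 1 / 2 < a) (s : ℝ) :
    HasDerivAt (fun b => profileA b s) (cosh (2 * s) / (2 * profileA a s)) a := by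
  have h := (((hasDerivAt_id' a).mul_const (cosh (2 * s))).add_const (1 / 2)).sqrt
    (by linarith [half_lt_mul_cosh ha s])
  exact h.congr_deriv (by rw [one_mul]; rfl)

theorem hasDerivAt_profileB_param (ha : 1 / 2 < a) (s : ℝ) :
    HasDerivAt (fun b => profileB b s) (cosh (2 * s) / (2 * profileB a s)) a := by
  have h := (((hasDerivAt_id' a).mul_const (cosh (2 * s))).sub_const (1 / 2)).sqrt
    (by linarith [half_lt_mul_cosh ha s])
  exact h.congr_deriv (by rw [one_mul]; rfl)

theorem hasDerivAt_angleDensity_param (ha : 1 / 2 < a) (t : ℝ) :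
    HasDerivAt (fun b => neckK b / (profileA b t ^ 2 * profileB b t))
      (angleDensityDeriv a t) a := by
  have hA := profileA_pos ha t
  have hB := profileB_pos ha t
  have hK := neckK_pos ha
  have h := (hasDerivAt_neckK ha).div
    (((hasDerivAt_profileA_param ha t).pow 2).mul (hasDerivAt_profileB_param ha t))
    (mul_pos (pow_pos hA 2) hB).ne'
  refine h.congr_deriv ?_
  simp only [Pi.mul_apply, Pi.pow_apply, angleDensityDeriv]
  field_simp
  ring

theorem continuous_neckK : Continuous neckK := by unfold neckK; fun_prop

theorem continuous_uncurry_profileA : Continuous fun p : ℝ × ℝ => profileA p.1 p.2 := by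
  unfold profileA; fun_prop

theorem continuous_uncurry_profileB : Continuous fun p : ℝ × ℝ => profileB p.1 p.2 := by
  unfold profileB; fun_prop

theorem continuousOn_angleDensity :
    ContinuousOn (Function.uncurry fun b t => neckK b / (profileA b t ^ 2 * profileB b t))
      (Ioi (1 / 2) ×ˢ univ) := by
  have hA := continuous_uncurry_profileA
  have hB := continuous_uncurry_profileB
  have hK := continuous_neckK
  refine ContinuousOn.div (by fun_prop) (by fun_prop) fun p hp => ?_
  have := profileA_pos hp.1 p.2
  have := profileB_pos hp.1 p.2
  positivity

theorem continuousOn_angleDensityDeriv :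
    ContinuousOn (Function.uncurry angleDensityDeriv) (Ioi (1 / 2) ×ˢ univ) := by
  have hA := continuous_uncurry_profileA
  have hB := continuous_uncurry_profileB
  have hK := continuous_neckK
  have hA0 : ∀ p ∈ (Ioi (1 / 2) ×ˢ univ : Set (ℝ × ℝ)), 0 < profileA p.1 p.2 :=
    fun p hp => profileA_pos hp.1 p.2
  have hB0 : ∀ p ∈ (Ioi (1 / 2) ×ˢ univ : Set (ℝ × ℝ)), 0 < profileB p.1 p.2 :=
    fun p hp => profileB_pos hp.1 p.2
  refine ContinuousOn.sub (ContinuousOn.sub (ContinuousOn.div (ContinuousOn.div (by fun_prop)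
    (by fun_prop) fun p hp => (neckK_pos hp.1).ne') (by fun_prop) fun p hp => ?_)
    (ContinuousOn.div (by fun_prop) (by fun_prop) fun p hp => ?_))
    (ContinuousOn.div (by fun_prop) (by fun_prop) fun p hp => ?_) <;>
  · have := hA0 p hp
    have := hB0 p hp
    positivity

theorem hasDerivAt_angle_param (ha : 1 / 2 < a) (s : ℝ) :
    HasDerivAt (fun b => angle b s) (angleParamDeriv a s) a :=
  hasDerivAt_parametric_primitive isOpen_Ioi continuousOn_angleDensity
    continuousOn_angleDensityDeriv (fun _ hb t => hasDerivAt_angleDensity_param hb t) ha s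

theorem hasStrictFDerivAt_angle (ha : 1 / 2 < a) (s : ℝ) :
    ∃ L : ℝ × ℝ →L[ℝ] ℝ, HasStrictFDerivAt (fun p : ℝ × ℝ => angle p.1 p.2) L (a, s) :=
  hasStrictFDerivAt_parametric_primitive isOpen_Ioi continuousOn_angleDensity
    continuousOn_angleDensityDeriv (fun _ hb t => hasDerivAt_angleDensity_param hb t) ha s

theorem hasDerivAt_angleParamDeriv (ha : 1 / 2 < a) (s : ℝ) :
    HasDerivAt (angleParamDeriv a) (angleDensityDeriv a s) s := by
  have hc : Continuous (angleDensityDeriv a) := continuousOn_univ.1 <|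
    continuousOn_angleDensityDeriv.comp (f := fun t => (a, t)) (by fun_prop)
      fun t _ => ⟨ha, mem_univ t⟩
  exact intervalIntegral.integral_hasDerivAt_right (hc.intervalIntegrable _ _)
    (hc.stronglyMeasurableAtFilter _ _) hc.continuousAt

theorem contDiffAt_neckK (ha : 1 / 2 < a) : ContDiffAt ℝ 1 neckK a :=
  ContDiffAt.sqrt (by fun_prop) (by nlinarith)

theorem contDiffAt_profileA (ha : 1 / 2 < a) (s : ℝ) :
    ContDiffAt ℝ 1 (fun p : ℝ × ℝ => profileA p.1 p.2) (a, s) :=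
  ContDiffAt.sqrt (by fun_prop) (by linarith [half_lt_mul_cosh ha s])

theorem contDiffAt_profileB (ha : 1 / 2 < a) (s : ℝ) :
    ContDiffAt ℝ 1 (fun p : ℝ × ℝ => profileB p.1 p.2) (a, s) :=
  ContDiffAt.sqrt (by fun_prop) (by linarith [half_lt_mul_cosh ha s])

theorem differentiableAt_uncurry_moriX (ha : 1 / 2 < a) (s θ : ℝ) :
    DifferentiableAt ℝ (fun p : ℝ × ℝ => moriX p.1 p.2 θ) (a, s) := by
  have hA := (contDiffAt_profileA ha s).differentiableAt one_ne_zero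
  have hB := (contDiffAt_profileB ha s).differentiableAt one_ne_zero
  obtain ⟨L, hL⟩ := hasStrictFDerivAt_angle ha s
  have hφ := hL.hasFDerivAt.differentiableAt
  rw [differentiableAt_pi]
  intro i
  fin_cases i
  · exact hA.mul hφ.cosh
  · exact hA.mul hφ.sinh
  · exact hB.mul_const _
  · exact hB.mul_const _

theorem differentiableAt_moriX_param (ha : 1 / 2 < a) (s θ : ℝ) :
    DifferentiableAt ℝ (fun b => moriX b s θ) a :=
  (differentiableAt_uncurry_moriX ha s θ).comp a (f := fun b => (b, s)) (by fun_prop)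

end Param

/-! ### Sign of the parametric Jacobi field -/

section JacobiField

variable {a : ℝ}

theorem phi_eq (ha : 1 / 2 < a) (s : ℝ) :
    phi a s = neckK a * cosh (2 * s) / (2 * profileA a s ^ 2 * profileB a s ^ 2)
      - angleParamDeriv a s * (a * sinh (2 * s)) / profileB a s := by
  have hA := profileA_pos ha s
  have hB := profileB_pos ha s
  have dA := hasDerivAt_profileA_param ha s
  have dB := hasDerivAt_profileB_param ha s
  have dφ := hasDerivAt_angle_param ha s
  have h0 := (dA.mul dφ.cosh).deriv
  have h1 := (dA.mul dφ.sinh).deriv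
  have h2 := dB.deriv
  simp only [phi, paramJacobi, lorentz, unitNormal, moriX, Matrix.cons_val, cos_zero, sin_zero,
    mul_one, mul_zero, add_zero]
  erw [h0, h1, h2]
  have h4 : profileA a s ^ 2 = profileB a s ^ 2 + 1 := by
    rw [profileA_sq ha, profileB_sq ha]; ring
  have hc := cosh_sq (angle a s)
  field_simp
  linear_combination
    (-(2 * profileB a s * profileA a s ^ 2 * angleParamDeriv a s * (a * sinh (2 * s)))
      - profileB a s ^ 2 * cosh (2 * s) * neckK a) * hc
    + cosh (2 * s) * neckK a * h4

theorem phi_zero_pos (ha : 1 / 2 < a) : 0 < phi a 0 := by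
  have hA := profileA_pos ha 0
  have hB := profileB_pos ha 0
  have hK := neckK_pos ha
  rw [phi_eq ha]
  simp only [mul_zero, sinh_zero, cosh_zero, zero_div, sub_zero, mul_one]
  positivity

/-- The quotient of `φ_a` by the Jacobi field `a sinh (2s) / B(s)`, which is up to sign the normal
component of the translations along the axis of rotation. -/
noncomputable def jacobiQuotient (a s : ℝ) : ℝ :=
  neckK a * cosh (2 * s) / (2 * profileA a s ^ 2 * profileB a s * (a * sinh (2 * s)))
    - angleParamDeriv a s

theorem phi_eq_jacobiQuotient_mul (ha : 1 / 2 < a) {s : ℝ} (hs : 0 < s) :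
    phi a s = jacobiQuotient a s * (a * sinh (2 * s) / profileB a s) := by
  have hA := profileA_pos ha s
  have hB := profileB_pos ha s
  have hS : 0 < a * sinh (2 * s) := mul_pos (by linarith) (sinh_pos_iff.2 (by linarith))
  rw [phi_eq ha, jacobiQuotient]
  set S := a * sinh (2 * s)
  field_simp

/-- The Wronskian of two Jacobi fields, weighted by `B`, is constant; this determines the
derivative of their quotient. -/
theorem hasDerivAt_jacobiQuotient (ha : 1 / 2 < a) {s : ℝ} (hs : 0 < s) :
    HasDerivAt (jacobiQuotient a)
      (-(a * profileB a s / (neckK a * (a * sinh (2 * s)) ^ 2))) s := by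
  have hA := profileA_pos ha s
  have hB := profileB_pos ha s
  have hK := neckK_pos ha
  have ha0 : 0 < a := by linarith
  have hS : 0 < sinh (2 * s) := sinh_pos_iff.2 (by linarith)
  have h2 : HasDerivAt (fun s : ℝ => 2 * s) 2 s := by simpa using (hasDerivAt_id s).const_mul 2
  have h := ((h2.cosh.const_mul (neckK a)).div
    (((((hasDerivAt_profileA ha s).pow 2).const_mul 2).mul (hasDerivAt_profileB ha s)).mul
      (h2.sinh.const_mul a)) (by simp only [Pi.mul_apply, Pi.pow_apply]; positivity)).sub
    (hasDerivAt_angleParamDeriv ha s)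
  refine h.congr_deriv ?_
  simp only [Pi.mul_apply, Pi.pow_apply, angleDensityDeriv]
  have eA := profileA_sq ha s
  have eB := profileB_sq ha s
  have eK := neckK_sq ha
  have eC := cosh_sq (2 * s)
  set A := profileA a s
  set B := profileB a s
  set K := neckK a
  set C := cosh (2 * s)
  set S := sinh (2 * s)
  have eS : S ^ 2 = C ^ 2 - 1 := by linarith
  have key : K ^ 2 * (2 * S ^ 2 * A ^ 2 * B ^ 2
      - C * (2 * S ^ 2 * a * B ^ 2 + S ^ 2 * a * A ^ 2 + 2 * A ^ 2 * B ^ 2 * C))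
      - S ^ 2 * a * (2 * B ^ 2 * (A ^ 2 * a - K ^ 2 * C) - K ^ 2 * A ^ 2 * C)
      + 2 * (A ^ 2) ^ 2 * (B ^ 2) ^ 2 = 0 := by
    rw [eA, eB, eK, eS]; ring
  field_simp
  norm_num
  linear_combination A * key

theorem jacobiQuotient_lt (ha : 1 / 2 < a) {s t : ℝ} (hs : 0 < s) (hst : s < t) :
    jacobiQuotient a t < jacobiQuotient a s := by
  refine strictAntiOn_of_hasDerivWithinAt_neg (convex_Ioi (0 : ℝ))
    (fun x hx => (hasDerivAt_jacobiQuotient ha hx).continuousAt.continuousWithinAt)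
    (fun x hx => (hasDerivAt_jacobiQuotient ha (by simpa using hx)).hasDerivWithinAt)
    (fun x hx => ?_) (mem_Ioi.2 hs) (mem_Ioi.2 (hs.trans hst)) hst
  rw [interior_Ioi] at hx
  have := profileB_pos ha x
  have := neckK_pos ha
  have ha0 : 0 < a := by linarith
  have hS : 0 < sinh (2 * x) := sinh_pos_iff.2 (by linarith [mem_Ioi.1 hx])
  rw [neg_lt_zero]
  positivity

/-- Since the quotient decreases, positivity of `φ_a` at the end of an interval `[0, t]` propagates
to all of it. -/
theorem phi_pos_of_phi_pos (ha : 1 / 2 < a) {s t : ℝ} (hs : 0 ≤ s) (hst : s ≤ t)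
    (ht : 0 < phi a t) : 0 < phi a s := by
  rcases hs.eq_or_lt with rfl | hs
  · exact phi_zero_pos ha
  rcases hst.eq_or_lt with rfl | hst
  · exact ht
  have hpos : ∀ x, 0 < x → 0 < a * sinh (2 * x) / profileB a x := fun x hx =>
    div_pos (mul_pos (by linarith) (sinh_pos_iff.2 (by linarith))) (profileB_pos ha x)
  rw [phi_eq_jacobiQuotient_mul ha (hs.trans hst), mul_pos_iff_of_pos_right (hpos t (hs.trans hst))]
    at ht
  rw [phi_eq_jacobiQuotient_mul ha hs, mul_pos_iff_of_pos_right (hpos s hs)]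
  exact ht.trans (jacobiQuotient_lt ha hs hst)

end JacobiField

/-! ### Differentiability of the free boundary parameter -/

section FreeBoundary

variable {a : ℝ}

/-- The difference of the two sides of the free boundary condition, cleared of denominators. -/
noncomputable def boundaryDefect (a s : ℝ) : ℝ :=
  sinh (angle a s) * (a * sinh (2 * s)) - profileB a s * neckK a * cosh (angle a s)

theorem isFreeBoundary_iff_boundaryDefect (ha : 1 / 2 < a) {s : ℝ} (hs : 0 < s) :
    IsFreeBoundary a s ↔ boundaryDefect a s = 0 := by
  have hS : 0 < a * sinh (2 * s) := mul_pos (by linarith) (sinh_pos_iff.2 (by linarith))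
  rw [IsFreeBoundary, and_iff_right hs, tanh_eq_sinh_div_cosh,
    div_eq_div_iff (cosh_pos _).ne' hS.ne', boundaryDefect, sub_eq_zero]

theorem s0_pos (ha : 1 / 2 < a) : 0 < s0 a := (isFreeBoundary_s0 ha).1

theorem mul_sinh_s0_pos (ha : 1 / 2 < a) : 0 < a * sinh (2 * s0 a) :=
  mul_pos (by linarith) (sinh_pos_iff.2 (by linarith [s0_pos ha]))

theorem boundaryDefect_s0 (ha : 1 / 2 < a) : boundaryDefect a (s0 a) = 0 :=
  (isFreeBoundary_iff_boundaryDefect ha (s0_pos ha)).1 (isFreeBoundary_s0 ha)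

theorem hasDerivAt_boundaryDefect (ha : 1 / 2 < a) (s : ℝ) :
    HasDerivAt (boundaryDefect a)
      (cosh (angle a s) * (neckK a / (profileA a s ^ 2 * profileB a s)) * (a * sinh (2 * s))
        + sinh (angle a s) * (a * (cosh (2 * s) * 2))
        - (a * sinh (2 * s) / profileB a s * neckK a * cosh (angle a s)
          + profileB a s * neckK a
            * (sinh (angle a s) * (neckK a / (profileA a s ^ 2 * profileB a s))))) s := by
  have h2 : HasDerivAt (fun s : ℝ => 2 * s) 2 s := by simpa using (hasDerivAt_id s).const_mul 2
  have hφ := hasDerivAt_angle ha s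
  exact (hφ.sinh.mul (h2.sinh.const_mul a)).sub
    (((hasDerivAt_profileB ha s).mul_const (neckK a)).mul hφ.cosh)

/-- At the free boundary, `∂ₛ` of the defect equals `cosh φ · K A² B / (a sinh (2s))`. -/
theorem deriv_boundaryDefect_s0_pos (ha : 1 / 2 < a) :
    0 < deriv (boundaryDefect a) (s0 a) := by
  rw [(hasDerivAt_boundaryDefect ha _).deriv]
  have h0 := boundaryDefect_s0 ha
  have hS := mul_sinh_s0_pos ha
  have hA := profileA_pos ha (s0 a)
  have hB := profileB_pos ha (s0 a)
  have hK := neckK_pos ha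
  have eA := profileA_sq ha (s0 a)
  have eB := profileB_sq ha (s0 a)
  have eM := mori_relation ha (s0 a)
  have hch := cosh_pos (angle a (s0 a))
  have eSh : sinh (angle a (s0 a))
      = profileB a (s0 a) * neckK a * cosh (angle a (s0 a)) / (a * sinh (2 * s0 a)) := by
    rw [eq_div_iff hS.ne']; rw [boundaryDefect] at h0; linarith
  rw [eSh]
  have hAB : profileB a (s0 a) ^ 2 = profileA a (s0 a) ^ 2 - 1 := by linarith
  have eC : a * (cosh (2 * s0 a) * 2) = 2 * profileA a (s0 a) ^ 2 - 1 := by linarith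
  rw [eC]
  set S := a * sinh (2 * s0 a)
  set A := profileA a (s0 a)
  set B := profileB a (s0 a)
  set K := neckK a
  set c := cosh (angle a (s0 a))
  have e : c * (K / (A ^ 2 * B)) * S + B * K * c / S * (2 * A ^ 2 - 1)
      - (S / B * K * c + B * K * (B * K * c / S * (K / (A ^ 2 * B)))) = c * K * A ^ 2 * B / S := by
    field_simp
    linear_combination (1 - A ^ 2) * eM - K ^ 2 * hAB
  rw [e]
  positivity

theorem hasStrictFDerivAt_boundaryDefect (ha : 1 / 2 < a) (s : ℝ) :
    ∃ L : ℝ × ℝ →L[ℝ] ℝ,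
      HasStrictFDerivAt (fun p : ℝ × ℝ => boundaryDefect p.1 p.2) L (a, s) := by
  obtain ⟨L, hφ⟩ := hasStrictFDerivAt_angle ha s
  have hS : ContDiffAt ℝ 1 (fun p : ℝ × ℝ => p.1 * sinh (2 * p.2)) (a, s) := by fun_prop
  have hBK : ContDiffAt ℝ 1 (fun p : ℝ × ℝ => profileB p.1 p.2 * neckK p.1) (a, s) :=
    (contDiffAt_profileB ha s).mul
      (ContDiffAt.comp (g := neckK) (a, s) (contDiffAt_neckK ha) contDiffAt_fst)
  exact ⟨_, (hφ.sinh.mul (hS.hasStrictFDerivAt one_ne_zero)).sub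
    ((hBK.hasStrictFDerivAt one_ne_zero).mul hφ.cosh)⟩

/-- The implicit function theorem, applied to the free boundary condition at `(a, s₀(a))`. -/
theorem differentiableAt_s0 (ha : 1 / 2 < a) : DifferentiableAt ℝ s0 a := by
  obtain ⟨L, hL⟩ := hasStrictFDerivAt_boundaryDefect ha (s0 a)
  have hcomp : HasFDerivAt (boundaryDefect a) (L ∘L .inr ℝ ℝ ℝ) (s0 a) :=
    hL.hasFDerivAt.comp (s0 a) (hasFDerivAt_prodMk_right a (s0 a))
  have hL1 : (L ∘L .inr ℝ ℝ ℝ) 1 = deriv (boundaryDefect a) (s0 a) := hcomp.hasDerivAt.deriv.symm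
  have hne := (deriv_boundaryDefect_s0_pos ha).ne'
  have hinv : (L ∘L .inr ℝ ℝ ℝ).IsInvertible := by
    refine ⟨ContinuousLinearEquiv.unitsEquivAut ℝ (Units.mk0 _ hne), ?_⟩
    ext
    simp [← hL1]
  have hψ := (hL.hasStrictFDerivAt_implicitFunctionOfProdDomain hinv).hasFDerivAt
  have hev := hL.eventually_apply_implicitFunctionOfProdDomain hinv
  have hlim := hL.tendsto_implicitFunctionOfProdDomain hinv
  refine hψ.differentiableAt.congr_of_eventuallyEq ?_
  filter_upwards [hev, hlim.eventually (lt_mem_nhds (s0_pos ha)), lt_mem_nhds ha] with b hb hpos hb2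
  rw [boundaryDefect_s0 ha] at hb
  exact (existsUnique_isFreeBoundary hb2).unique (isFreeBoundary_s0 hb2)
    ((isFreeBoundary_iff_boundaryDefect hb2 hpos).2 hb)

end FreeBoundary

/-! ### The boundary circle of the critical catenoid -/

section BoundaryCircle

variable {a : ℝ}

/-- The point of the boundary circle at `θ = 0`. -/
noncomputable def boundaryPoint (a : ℝ) : Fin 4 → ℝ := moriX a (s0 a) 0

/-- By the free boundary condition `A² (B² - K²) = (a sinh (2s))² - (B K)²`, which is positive
because `tanh φ < 1`. -/
theorem neckK_sq_lt_profileB_s0_sq (ha : 1 / 2 < a) : neckK a ^ 2 < profileB a (s0 a) ^ 2 := by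
  have h0 := boundaryDefect_s0 ha
  have hA := profileA_pos ha (s0 a)
  have hB := profileB_pos ha (s0 a)
  have hK := neckK_pos ha
  have hS := mul_sinh_s0_pos ha
  have hch := cosh_pos (angle a (s0 a))
  have eM := mori_relation ha (s0 a)
  have hAB : profileA a (s0 a) ^ 2 = profileB a (s0 a) ^ 2 + 1 := by
    rw [profileA_sq ha, profileB_sq ha]; ring
  rw [boundaryDefect] at h0
  have hBK : profileB a (s0 a) * neckK a < a * sinh (2 * s0 a) := by
    have hlt : sinh (angle a (s0 a)) < cosh (angle a (s0 a)) := sinh_lt_cosh _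
    have h1 := mul_lt_mul_of_pos_right hlt hS
    refine lt_of_mul_lt_mul_right ?_ hch.le
    linarith
  have hsq := pow_lt_pow_left₀ hBK (by positivity) two_ne_zero
  have : 0 < profileA a (s0 a) ^ 2 * (profileB a (s0 a) ^ 2 - neckK a ^ 2) := by
    have e : (a * sinh (2 * s0 a)) ^ 2 - (profileB a (s0 a) * neckK a) ^ 2
      = profileA a (s0 a) ^ 2 * (profileB a (s0 a) ^ 2 - neckK a ^ 2) := by
      linear_combination eM + neckK a ^ 2 * hAB
    rw [← e]; linarith
  have := pos_of_mul_pos_right this (sq_nonneg _)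
  linarith

theorem boundaryPoint_one_pos (ha : 1 / 2 < a) : 0 < boundaryPoint a 1 := by
  have h := angle_strictMono ha (s0_pos ha)
  rw [show angle a 0 = 0 by simp [angle]] at h
  exact mul_pos (profileA_pos ha _) (sinh_pos_iff.2 h)

theorem boundaryPoint_two (a : ℝ) : boundaryPoint a 2 = profileB a (s0 a) := by
  simp [boundaryPoint, moriX]

theorem ratioY_mul (ha : 1 / 2 < a) : ratioY a * neckK a ^ 2 = boundaryPoint a 2 ^ 2 := by
  rw [boundaryPoint_two, ratioY, div_mul_cancel₀ _ (pow_pos (neckK_pos ha) 2).ne']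

theorem one_lt_ratioY (ha : 1 / 2 < a) : 1 < ratioY a :=
  (one_lt_div (pow_pos (neckK_pos ha) 2)).2 (neckK_sq_lt_profileB_s0_sq ha)

/-- The free boundary condition in terms of the boundary point and `y(a)`. -/
theorem boundaryPoint_one_sq_mul (ha : 1 / 2 < a) :
    boundaryPoint a 1 ^ 2 * (ratioY a - 1) = boundaryPoint a 2 ^ 2 := by
  have h0 := boundaryDefect_s0 ha
  have hK := neckK_pos ha
  have hcs := cosh_sq (angle a (s0 a))
  have eM := mori_relation ha (s0 a)
  have hAB : profileA a (s0 a) ^ 2 = profileB a (s0 a) ^ 2 + 1 := by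
    rw [profileA_sq ha, profileB_sq ha]; ring
  rw [boundaryDefect, sub_eq_zero] at h0
  have h1 := congrArg (· ^ 2) h0
  simp only [mul_pow] at h1
  have e1 : boundaryPoint a 1 = profileA a (s0 a) * sinh (angle a (s0 a)) := rfl
  refine mul_right_cancel₀ (pow_pos hK 2).ne' ?_
  have e2 := ratioY_mul ha
  rw [boundaryPoint_two] at e2 ⊢
  rw [e1]
  linear_combination (profileA a (s0 a) * sinh (angle a (s0 a))) ^ 2 * e2 + h1
    + profileB a (s0 a) ^ 2 * neckK a ^ 2 * hcs - sinh (angle a (s0 a)) ^ 2 * eM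
    - sinh (angle a (s0 a)) ^ 2 * neckK a ^ 2 * hAB

theorem lorentz_pole (p : Fin 4 → ℝ) : -lorentz pole p = p 0 := by
  simp [lorentz, pole]

theorem boundaryPoint_zero_sq (ha : 1 / 2 < a) :
    boundaryPoint a 0 ^ 2 = 1 + boundaryPoint a 1 ^ 2 + boundaryPoint a 2 ^ 2 := by
  have h := lorentz_moriX_self ha (s0 a) 0
  have h3 : moriX a (s0 a) 0 3 = 0 := by simp [moriX]
  rw [lorentz, h3] at h
  simp only [boundaryPoint]
  linarith

theorem one_lt_boundaryPoint_zero (ha : 1 / 2 < a) : 1 < boundaryPoint a 0 := by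
  have h : 0 < boundaryPoint a 0 := mul_pos (profileA_pos ha _) (cosh_pos _)
  have := boundaryPoint_zero_sq ha
  have := pow_pos (boundaryPoint_one_pos ha) 2
  nlinarith [sq_nonneg (boundaryPoint a 2)]

theorem radius_eq (a : ℝ) : radius a = arcosh (boundaryPoint a 0) := by
  rw [radius, hypDist, lorentz_pole, boundaryPoint]

theorem radius_pos (ha : 1 / 2 < a) : 0 < radius a := by
  rw [radius_eq]; exact arcosh_pos (one_lt_boundaryPoint_zero ha)

theorem sinh_radius_sq (ha : 1 / 2 < a) :
    sinh (radius a) ^ 2 = boundaryPoint a 1 ^ 2 + boundaryPoint a 2 ^ 2 := by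
  have h := cosh_arcosh (one_lt_boundaryPoint_zero ha).le
  rw [← radius_eq] at h
  have := cosh_sq (radius a)
  rw [h, boundaryPoint_zero_sq ha] at this
  linarith

/-- `(sinh r / K)² = y² / (y - 1)`. -/
theorem sinh_radius_div_sq_mul (ha : 1 / 2 < a) :
    (sinh (radius a) / neckK a) ^ 2 * (ratioY a - 1) = ratioY a ^ 2 := by
  have hK := neckK_pos ha
  rw [div_pow, sinh_radius_sq ha]
  field_simp
  linear_combination boundaryPoint_one_sq_mul ha - ratioY a * ratioY_mul ha

theorem differentiableAt_boundaryPoint (ha : 1 / 2 < a) : DifferentiableAt ℝ boundaryPoint a :=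
  (differentiableAt_uncurry_moriX ha (s0 a) 0).comp a (f := fun b => (b, s0 b))
    (differentiableAt_id.prodMk (differentiableAt_s0 ha))

theorem differentiableAt_radius (ha : 1 / 2 < a) : DifferentiableAt ℝ radius a := by
  rw [show radius = fun b => arcosh (boundaryPoint b 0) from funext radius_eq]
  exact DifferentiableAt.comp (g := arcosh) a
    (differentiableAt_arcosh (one_lt_boundaryPoint_zero ha))
    (differentiableAt_pi.1 (differentiableAt_boundaryPoint ha) 0)

theorem differentiableAt_ratioY (ha : 1 / 2 < a) : DifferentiableAt ℝ ratioY a := by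
  have h := differentiableAt_pi.1 (differentiableAt_boundaryPoint ha) 2
  simp only [boundaryPoint_two] at h
  exact (h.pow 2).div ((hasDerivAt_neckK ha).differentiableAt.pow 2)
    (pow_pos (neckK_pos ha) 2).ne'

/-- Moving the boundary parameter along with `a` adds to `∂ₐ X` a tangential term only. -/
theorem phi_s0_eq_lorentz_deriv (ha : 1 / 2 < a) :
    phi a (s0 a) = lorentz (deriv boundaryPoint a) (unitNormal a (s0 a) 0) := by
  have hF := (differentiableAt_uncurry_moriX ha (s0 a) 0).hasFDerivAt
  set F := fderiv ℝ (fun p : ℝ × ℝ => moriX p.1 p.2 0) (a, s0 a)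
  have h1 : HasDerivAt (fun b => moriX b (s0 a) 0) (F (1, 0)) a :=
    hF.comp_hasDerivAt a (f := fun b => (b, s0 a))
      ((hasDerivAt_id a).prodMk (hasDerivAt_const a (s0 a)))
  have h2 : HasDerivAt (fun s => moriX a s 0) (F (0, 1)) (s0 a) :=
    hF.comp_hasDerivAt (s0 a) (f := fun s => (a, s))
      ((hasDerivAt_const (s0 a) a).prodMk (hasDerivAt_id (s0 a)))
  have h3 : HasDerivAt boundaryPoint (F (1, deriv s0 a)) a :=
    hF.comp_hasDerivAt a (f := fun b => (b, s0 b))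
      ((hasDerivAt_id a).prodMk (differentiableAt_s0 ha).hasDerivAt)
  have hsplit : F (1, deriv s0 a) = F (1, 0) + deriv s0 a • F (0, 1) := by
    rw [← map_smul, ← map_add]; simp
  have hν := lorentz_normal_deriv_s ha (s0 a) 0
  rw [h2.deriv] at hν
  have hφ : phi a (s0 a) = lorentz (F (1, 0)) (unitNormal a (s0 a) 0) := by
    rw [phi, paramJacobi]
    congr 1
    exact funext fun i => (hasDerivAt_pi.1 h1 i).deriv
  rw [hφ, h3.deriv, hsplit]
  simp only [lorentz, Pi.add_apply, Pi.smul_apply, smul_eq_mul] at hν ⊢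
  linear_combination (-deriv s0 a) * hν

/-- Since `ν` is orthogonal to `p₀` and to the boundary point `P`, the number `φ_a(s₀)` measures the
rotation of `P` around `p₀`, that is, the change of the elevation of `P`, whose sine is `1 / √y`.
An increase of `y` lowers the elevation, which moves `P` to the side of `ν`. -/
theorem two_mul_phi_s0 (ha : 1 / 2 < a) :
    2 * boundaryPoint a 2 ^ 2 * phi a (s0 a)
      = neckK a * boundaryPoint a 1 ^ 2 * deriv ratioY a := by
  have hP := hasDerivAt_pi.1 (differentiableAt_boundaryPoint ha).hasDerivAt
  have hy := (differentiableAt_ratioY ha).hasDerivAt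
  have hrel : (((fun b => boundaryPoint b 1) ^ 2 * fun b => ratioY b - 1) : ℝ → ℝ)
      =ᶠ[𝓝 a] (fun b => boundaryPoint b 2) ^ 2 := by
    filter_upwards [lt_mem_nhds ha] with b hb using boundaryPoint_one_sq_mul hb
  have hd := (((hP 1).pow 2).mul (hy.sub_const 1)).unique
    (((hP 2).pow 2).congr_of_eventuallyEq hrel)
  have hν0 := (isFreeBoundary_iff ha (s0_pos ha)).1 (isFreeBoundary_s0 ha)
  have hνP := lorentz_normal_moriX ha (s0 a) 0
  have hν2 : unitNormal a (s0 a) 0 2 * boundaryPoint a 2 = neckK a := by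
    have := profileB_pos ha (s0 a)
    rw [boundaryPoint_two]
    simp [unitNormal]
    field_simp
  have h3 : unitNormal a (s0 a) 0 3 = 0 := by simp [unitNormal]
  have e0 : unitNormal a (s0 a) 0 0 = 0 := by
    simpa [lorentz, pole] using hν0
  have e1 : boundaryPoint a 1 * unitNormal a (s0 a) 0 1
      + boundaryPoint a 2 * unitNormal a (s0 a) 0 2 = 0 := by
    have : lorentz (unitNormal a (s0 a) 0) (boundaryPoint a) = 0 := hνP
    simp only [lorentz, e0, h3] at this
    linarith
  have hφ := phi_s0_eq_lorentz_deriv ha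
  simp only [lorentz, e0, h3] at hφ
  have hrel0 := boundaryPoint_one_sq_mul ha
  have hp := boundaryPoint_one_pos ha
  simp only [Pi.pow_apply] at hd
  norm_num at hd
  rw [hφ]
  set p := boundaryPoint a 1
  set q := boundaryPoint a 2
  set p' := deriv boundaryPoint a 1
  set q' := deriv boundaryPoint a 2
  set n1 := unitNormal a (s0 a) 0 1
  set n2 := unitNormal a (s0 a) 0 2
  refine mul_left_cancel₀ hp.ne' ?_
  linear_combination 2 * q ^ 2 * p' * e1 + (2 * q * (q' * p - p' * q)) * hν2
    - neckK a * p * hd + 2 * neckK a * p' * hrel0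

end BoundaryCircle

/-! ### The strict pinching condition -/

section Pinching

variable {a : ℝ}

theorem one_add_sq_div_two_le_cosh (x : ℝ) : 1 + x ^ 2 / 2 ≤ cosh x := by
  have h : |x / 2| ≤ |sinh (x / 2)| := by
    rcases le_total 0 x with hx | hx
    · have := self_le_sinh_iff.2 (by linarith : 0 ≤ x / 2)
      rwa [abs_of_nonneg (by linarith), abs_of_nonneg (by linarith)]
    · have := sinh_le_self_iff.2 (by linarith : x / 2 ≤ 0)
      rw [abs_of_nonpos (by linarith), abs_of_nonpos (by linarith)]
      linarith
  have h2 := sq_le_sq.2 h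
  have h3 := cosh_two_mul (x / 2)
  rw [cosh_sq, mul_div_cancel₀ _ (two_ne_zero' ℝ)] at h3
  nlinarith

theorem add_pow_three_div_le_sinh {t : ℝ} (ht : 0 ≤ t) : t + t ^ 3 / 8 ≤ sinh t := by
  have h1 := self_le_sinh_iff.2 (by linarith : 0 ≤ t / 2)
  have h2 := one_add_sq_div_two_le_cosh (t / 2)
  have h3 := sinh_two_mul (t / 2)
  rw [mul_div_cancel₀ _ (two_ne_zero' ℝ)] at h3
  have h4 := mul_le_mul h1 h2 (by positivity) (by linarith)
  rw [h3]
  nlinarith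

/-- With `t = (x² + 1) / (√2 x)` the claim is `x < sinh t`, and the bound `t + t³ / 8 ≤ sinh t` is
enough for it. -/
theorem sqrt_two_mul_arsinh_lt {x : ℝ} (hx : 0 < x) : √2 * x * arsinh x < x ^ 2 + 1 := by
  have h2 : 0 < √2 := by positivity
  have h2s : √2 ^ 2 = 2 := sq_sqrt (by norm_num)
  have h2u : √2 < 71 / 50 := by rw [sqrt_lt' (by norm_num)]; norm_num
  set t := (x ^ 2 + 1) / (√2 * x) with ht
  have ht0 : 0 < t := by positivity
  have hxt : √2 * x * t = x ^ 2 + 1 := by rw [ht]; field_simp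
  suffices h : arsinh x < t by
    rw [← hxt]; exact mul_lt_mul_of_pos_left h (by positivity)
  rw [← arsinh_sinh t, arsinh_lt_arsinh]
  refine lt_of_lt_of_le ?_ (add_pow_three_div_le_sinh ht0.le)
  refine lt_of_mul_lt_mul_left ?_ (by positivity : 0 ≤ √2 * x * (2 * x ^ 2))
  have hsq : 2 * x ^ 2 * t ^ 2 = (x ^ 2 + 1) ^ 2 := by rw [← hxt, mul_pow, mul_pow, h2s]
  have e : √2 * x * (2 * x ^ 2) * (t + t ^ 3 / 8)
      = (x ^ 2 + 1) * (2 * x ^ 2) + (x ^ 2 + 1) * (x ^ 2 + 1) ^ 2 / 8 := by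
    linear_combination (2 * x ^ 2 + (2 * x ^ 2 * t ^ 2) / 8) * hxt + (x ^ 2 + 1) / 8 * hsq
  rw [e]
  have h5 := mul_lt_mul_of_pos_right h2u (by positivity : 0 < 2 * (x ^ 2) ^ 2)
  have hz : 0 < x ^ 2 := by positivity
  have e2 : √2 * x * (2 * x ^ 2) * x = √2 * (2 * (x ^ 2) ^ 2) := by ring
  rw [e2]
  nlinarith [mul_nonneg hz.le (sq_nonneg (x ^ 2 - 2))]

theorem sinh_le_mul_cosh {x : ℝ} (hx : 0 ≤ x) : sinh x ≤ x * cosh x := by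
  have hd : ∀ t : ℝ, HasDerivAt (fun t => t * cosh t - sinh t) (t * sinh t) t := fun t =>
    (((hasDerivAt_id' t).mul (hasDerivAt_cosh t)).sub (hasDerivAt_sinh t)).congr_deriv (by ring)
  have hmono : Monotone fun t : ℝ => t * cosh t - sinh t := by
    refine monotone_of_hasDerivAt_nonneg hd fun t => ?_
    rcases le_total 0 t with ht | ht
    · exact mul_nonneg ht (sinh_nonneg_iff.2 ht)
    · exact mul_nonneg_of_nonpos_of_nonpos ht (sinh_nonpos_iff.2 ht)
  have h := hmono hx
  simpa using h

/-- Comparison of the angle with an explicit primitive, from `A² ≥ a + 1/2` and `cosh ≥ 1`. -/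
theorem angle_le_arsinh (ha : 1 / 2 < a) {s : ℝ} (hs : 0 ≤ s) :
    angle a s ≤ neckK a / ((a + 1 / 2) * √(2 * a))
      * arsinh (√(2 * a / (a - 1 / 2)) * sinh s) := by
  have hm : 0 < a - 1 / 2 := by linarith
  have hK := neckK_pos ha
  set k := √(2 * a / (a - 1 / 2)) with hk
  have hx : 0 < √(2 * a) := sqrt_pos.2 (by linarith)
  have hxs : √(2 * a) ^ 2 = 2 * a := sq_sqrt (by linarith)
  have hk0 : 0 < k := sqrt_pos.2 (by positivity)
  have hks : k ^ 2 * (a - 1 / 2) = 2 * a := by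
    rw [hk, sq_sqrt (by positivity)]; exact div_mul_cancel₀ _ hm.ne'
  set c := neckK a / ((a + 1 / 2) * √(2 * a)) with hc
  have hd : ∀ t, HasDerivAt (fun t => c * arsinh (k * sinh t) - angle a t)
      (c * ((√(1 + (k * sinh t) ^ 2))⁻¹ • (k * cosh t))
        - neckK a / (profileA a t ^ 2 * profileB a t)) t := fun t =>
    ((((hasDerivAt_sinh t).const_mul k).arsinh).const_mul c).sub (hasDerivAt_angle ha t)
  have hmono : Monotone fun t => c * arsinh (k * sinh t) - angle a t := by
    refine monotone_of_hasDerivAt_nonneg hd fun t => ?_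
    have hA := profileA_sq ha t
    have hB := profileB_pos ha t
    have hC := cosh_two_mul t
    have hcs := cosh_sq t
    have hroot : √(1 + (k * sinh t) ^ 2) * √(2 * a) = k * profileB a t := by
      refine (pow_left_inj₀ (by positivity) (by positivity) two_ne_zero).1 ?_
      rw [mul_pow, mul_pow k (profileB a t), sq_sqrt (by positivity), hxs, profileB_sq ha, hC, hcs]
      linear_combination (-1 : ℝ) * hks
    have hr : 0 < √(1 + (k * sinh t) ^ 2) := by positivity
    have e : c * ((√(1 + (k * sinh t) ^ 2))⁻¹ • (k * cosh t))
        = neckK a * cosh t / ((a + 1 / 2) * profileB a t) := by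
      rw [hc, smul_eq_mul]
      have : 0 < a + 1 / 2 := by linarith
      rw [div_mul_eq_mul_div, div_eq_div_iff (by positivity) (by positivity)]
      have e1 : (√(1 + (k * sinh t) ^ 2))⁻¹ * k * profileB a t = √(2 * a) := by
        rw [mul_assoc, ← hroot, inv_mul_cancel_left₀ hr.ne']
      linear_combination neckK a * cosh t * (a + 1 / 2) * e1
    show 0 ≤ _ - _
    rw [e, sub_nonneg]
    have h1 := one_le_cosh t
    have h2 : a + 1 / 2 ≤ profileA a t ^ 2 := by rw [hA]; nlinarith [one_le_cosh (2 * t)]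
    have h3 : 0 < a + 1 / 2 := by linarith
    have h4 : neckK a ≤ neckK a * cosh t := by nlinarith
    gcongr
  have h := hmono hs
  simp [angle] at h
  simpa [angle] using h

/-- The pinching condition holds for every `a > 1/2`. If `B² ≤ 2 K²` at the free boundary, then
there `tanh φ ≥ K / (√2 a)` by the free boundary condition, against the upper bound for `φ`. -/
theorem two_lt_ratioY (ha : 1 / 2 < a) : 2 < ratioY a := by
  by_contra! hle
  have hK := neckK_pos ha
  have hB := profileB_pos ha (s0 a)
  have hS := mul_sinh_s0_pos ha
  have hs := s0_pos ha
  have hm : 0 < a - 1 / 2 := by linarith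
  have ha0 : 0 < a := by linarith
  have eK := neckK_sq ha
  have eB := profileB_sq ha (s0 a)
  have eM := mori_relation ha (s0 a)
  have hAB : profileA a (s0 a) ^ 2 = profileB a (s0 a) ^ 2 + 1 := by
    rw [profileA_sq ha, profileB_sq ha]; ring
  have hC := cosh_two_mul (s0 a)
  have hcs := cosh_sq (s0 a)
  have hB2 : profileB a (s0 a) ^ 2 ≤ 2 * neckK a ^ 2 := by
    rwa [ratioY, div_le_iff₀ (by positivity)] at hle
  set x := √(2 * a) with hx
  have hx0 : 0 < x := sqrt_pos.2 (by linarith)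
  have hxs : x ^ 2 = 2 * a := sq_sqrt (by linarith)
  have h2 : 0 < √2 := by positivity
  have h2s : √2 ^ 2 = 2 := sq_sqrt (by norm_num)
  -- the argument of `arsinh` in the comparison function is at most `√(2a)`
  have harg : √(2 * a / (a - 1 / 2)) * sinh (s0 a) ≤ x := by
    refine le_of_sq_le_sq ?_ hx0.le
    rw [mul_pow, sq_sqrt (by positivity), hxs, div_mul_eq_mul_div, div_le_iff₀ hm]
    rw [hC, hcs] at eB
    nlinarith
  have hφ : angle a (s0 a) ≤ neckK a / ((a + 1 / 2) * x) * arsinh x :=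
    (angle_le_arsinh ha hs.le).trans <|
      mul_le_mul_of_nonneg_left (arsinh_le_arsinh.2 harg) (by positivity)
  have htanh : tanh (angle a (s0 a)) ≤ angle a (s0 a) := by
    have h0 : 0 ≤ angle a (s0 a) := by
      have h := angle_strictMono ha hs
      rw [show angle a 0 = 0 by simp [angle]] at h
      exact h.le
    rw [tanh_eq_sinh_div_cosh, div_le_iff₀ (cosh_pos _)]
    exact sinh_le_mul_cosh h0
  have hlow : neckK a / (√2 * a) ≤ tanh (angle a (s0 a)) := by
    rw [(isFreeBoundary_s0 ha).2]
    refine le_of_sq_le_sq ?_ (by positivity)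
    rw [div_pow, div_pow, mul_pow, mul_pow, h2s, div_le_div_iff₀ (by positivity) (by positivity)]
    have e : (a * sinh (2 * s0 a)) ^ 2 = profileB a (s0 a) ^ 2 * (profileB a (s0 a) ^ 2 + 1)
        - neckK a ^ 2 := by rw [← hAB]; linarith
    rw [e]
    have h5 : 0 ≤ (2 * neckK a ^ 2 - profileB a (s0 a) ^ 2) * (profileB a (s0 a) ^ 2 + 1 / 2) :=
      mul_nonneg (by linarith) (by positivity)
    have h6 := mul_nonneg (sq_nonneg (neckK a)) h5
    have e2 : a ^ 2 = neckK a ^ 2 + 1 / 4 := by linarith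
    rw [e2]
    linarith
  have hup : neckK a / ((a + 1 / 2) * x) * arsinh x < neckK a / (√2 * a) := by
    have h7 := sqrt_two_mul_arsinh_lt hx0
    rw [hxs] at h7
    rw [div_mul_eq_mul_div, div_lt_div_iff₀ (by positivity) (by positivity)]
    have h8 : 0 < neckK a * x / 2 := by positivity
    have h9 := mul_lt_mul_of_pos_left h7 h8
    have e3 : neckK a * x / 2 * (√2 * x * arsinh x) = neckK a * arsinh x * (√2 * a) := by
      linear_combination neckK a * √2 * arsinh x / 2 * hxs
    rw [e3] at h9
    linarith
  linarith

end Pinching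

/-! ### The equivalences -/

section Equivalences

variable {a : ℝ}

theorem two_mul_neckK_sq_lt_iff (ha : 1 / 2 < a) :
    2 * neckK a ^ 2 < profileB a (s0 a) ^ 2 ↔ 2 < ratioY a :=
  (lt_div_iff₀ (pow_pos (neckK_pos ha) 2)).symm

theorem sinh_radius_pos (ha : 1 / 2 < a) : 0 < sinh (radius a) := sinh_pos_iff.2 (radius_pos ha)

/-- By `(sinh r / K)² = y² / (y - 1)`, the condition `sinh r > 2 K` amounts to `(y - 2)² > 0`. -/
theorem two_mul_neckK_lt_sinh_iff (ha : 1 / 2 < a) :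
    2 * neckK a < sinh (radius a) ↔ ratioY a ≠ 2 := by
  have hK := neckK_pos ha
  have hy := one_lt_ratioY ha
  have hz := sinh_radius_div_sq_mul ha
  have hz0 : 0 < sinh (radius a) / neckK a := div_pos (sinh_radius_pos ha) hK
  rw [← lt_div_iff₀ hK, ← sq_lt_sq₀ zero_le_two hz0.le,
    ← mul_lt_mul_iff_left₀ (sub_pos.2 hy), hz, ← sub_ne_zero, ← sq_pos_iff]
  constructor <;> intro h <;> nlinarith

theorem phi_s0_pos_iff (ha : 1 / 2 < a) : 0 < phi a (s0 a) ↔ 0 < deriv ratioY a := by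
  have hK := neckK_pos ha
  have hp := boundaryPoint_one_pos ha
  have hq : 0 < boundaryPoint a 2 := by rw [boundaryPoint_two]; exact profileB_pos ha _
  rw [← mul_pos_iff_of_pos_left (b := phi a (s0 a)) (by positivity : 0 < 2 * boundaryPoint a 2 ^ 2),
    two_mul_phi_s0 ha, mul_pos_iff_of_pos_left (by positivity)]

theorem hasDerivAt_sinh_radius_div (ha : 1 / 2 < a) :
    HasDerivAt (fun b => sinh (radius b) / neckK b)
      ((cosh (radius a) * deriv radius a * neckK a - sinh (radius a) * (a / neckK a))
        / neckK a ^ 2) a :=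
  (differentiableAt_radius ha).hasDerivAt.sinh.div (hasDerivAt_neckK ha) (neckK_pos ha).ne'

/-- The function `y² / (y - 1)` is strictly increasing for `y > 2`. -/
theorem deriv_sinh_radius_div_pos_iff (ha : 1 / 2 < a) (hy2 : 2 < ratioY a) :
    0 < deriv (fun b => sinh (radius b) / neckK b) a ↔ 0 < deriv ratioY a := by
  have hz0 : 0 < sinh (radius a) / neckK a := div_pos (sinh_radius_pos ha) (neckK_pos ha)
  have hz := (hasDerivAt_sinh_radius_div ha).differentiableAt.hasDerivAt
  have hy := (differentiableAt_ratioY ha).hasDerivAt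
  have hrel : (((fun b => sinh (radius b) / neckK b) ^ 2 * fun b => ratioY b - 1) : ℝ → ℝ)
      =ᶠ[𝓝 a] ratioY ^ 2 := by
    filter_upwards [lt_mem_nhds ha] with b hb using sinh_radius_div_sq_mul hb
  have hd := ((hz.pow 2).mul (hy.sub_const 1)).unique ((hy.pow 2).congr_of_eventuallyEq hrel)
  have h0 := sinh_radius_div_sq_mul ha
  simp only [Pi.pow_apply] at hd
  norm_num at hd
  set z := sinh (radius a) / neckK a
  set y := ratioY a
  set z' := deriv (fun b => sinh (radius b) / neckK b) a
  set y' := deriv ratioY a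
  have hy1 : 0 < y - 1 := by linarith
  have e : 2 * z * (y - 1) ^ 2 * z' = y * (y - 2) * y' := by
    linear_combination (y - 1) * hd - y' * h0
  rw [← mul_pos_iff_of_pos_left (b := z') (by positivity : 0 < 2 * z * (y - 1) ^ 2), e,
    mul_pos_iff_of_pos_left (mul_pos (by linarith) (by linarith))]

theorem deriv_sinh_radius_div_pos_iff_coth (ha : 1 / 2 < a) :
    0 < deriv (fun b => sinh (radius b) / neckK b) a ↔
      a < neckK a ^ 2 * deriv radius a * (cosh (radius a) / sinh (radius a)) := by
  have hK := neckK_pos ha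
  have hs := sinh_radius_pos ha
  rw [(hasDerivAt_sinh_radius_div ha).deriv, div_pos_iff_of_pos_right (pow_pos hK 2), sub_pos,
    ← mul_div_assoc (sinh _), div_lt_iff₀ hK, ← mul_div_assoc (neckK a ^ 2 * _), lt_div_iff₀ hs]
  constructor <;> intro h <;> linarith

theorem lt_mul_coth_iff_mul_tanh_lt (ha : 1 / 2 < a) :
    a < neckK a ^ 2 * deriv radius a * (cosh (radius a) / sinh (radius a)) ↔
      a * tanh (radius a) < (a ^ 2 - 1 / 4) * deriv radius a := by
  have hs := sinh_radius_pos ha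
  rw [neckK_sq ha, tanh_eq_sinh_div_cosh, ← mul_div_assoc, ← mul_div_assoc, lt_div_iff₀ hs,
    div_lt_iff₀ (cosh_pos _)]

end Equivalences
end HypCatenoid

theorem mainTheorem4 (a : ℝ) (ha : 1 / 2 < a) :
    (∀ s θ : ℝ, DifferentiableAt ℝ (fun b => moriX b s θ) a) ∧
    DifferentiableAt ℝ radius a ∧
    DifferentiableAt ℝ ratioY a ∧
    (2 * neckK a ^ 2 < profileB a (s0 a) ^ 2 ↔ 2 * neckK a < sinh (radius a)) ∧
    (2 * neckK a < sinh (radius a) →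
      List.TFAE [
        ∀ s ∈ Set.Icc 0 (s0 a), 0 < phi a s,
        0 < phi a (s0 a),
        a < neckK a ^ 2 * deriv radius a * (cosh (radius a) / sinh (radius a)),
        a * tanh (radius a) < (a ^ 2 - 1 / 4) * deriv radius a,
        0 < deriv (fun b => sinh (radius b) / neckK b) a,
        0 < deriv ratioY a]) := by
  have hy := two_lt_ratioY ha
  refine ⟨differentiableAt_moriX_param ha, differentiableAt_radius ha, differentiableAt_ratioY ha,
    ?_, fun _ => ?_⟩
  · rw [two_mul_neckK_sq_lt_iff ha, two_mul_neckK_lt_sinh_iff ha]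
    exact ⟨fun h => h.ne', fun _ => hy⟩
  · tfae_have 1 → 2 := fun h => h _ ⟨(s0_pos ha).le, le_rfl⟩
    tfae_have 2 → 1 := fun h _ hs => phi_pos_of_phi_pos ha hs.1 hs.2 h
    tfae_have 2 ↔ 6 := phi_s0_pos_iff ha
    tfae_have 5 ↔ 6 := deriv_sinh_radius_div_pos_iff ha hy
    tfae_have 5 ↔ 3 := deriv_sinh_radius_div_pos_iff_coth ha
    tfae_have 3 ↔ 4 := lt_mul_coth_iff_mul_tanh_lt ha
    tfae_finish
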